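/- There is an absolute constant $c>0$ such that the following holds. Let $p\in(1,2]$, let $n,U,N,k$ be positive integers, $r\ge 0$ an integer, and suppose that $$n\le U,\qquad 2^r N k^{1-1/p}\le n^{1-1/p},\qquad 2^r N k\le n .$$ Consider insertion-only streams $x_1,\dots,x_m$ of items from $[U]$, where $m\ge 2n$. For $n\le t\le m$, the $F_p$ moment of the window $x_{t-n+1},\dots,x_t$ is $\sum_{i\in[U]} f_i^p$, where $f_i$ is the number of occurrences of $i$ in the window. Let $\mathcal A$ be a randomized one-pass streaming algorithm such that, for every fixed stream and every fixed time $t$ with $n\le t\le m$, with probability at least $9/10$ the answer $\hat F$ of $\mathcal A$ to a query at time $t$ satisfies $$\Bigl(1-\tfrac{1}{12k^{1/p}}\Bigr)F_p\le \hat F\le \Bigl(1+\tfrac{1}{12k^{1/p}}\Bigr)F_p ,$$ where $F_p$ is the moment of the window $x_{t-n+1},\dots,x_t$. Then $\mathcal A$ uses at least $c\,k\,r\log N$ bits of space: if on every stream of length $m$ the memory of $\mathcal A$ almost surely consists, at each time, of at most $s$ bits, then $s\ge c\,k\,r\log N$. This holds even if random bits and a clock are available to $\mathcal A$ free of charge and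 only the bits kept in memory between updates are counted. -/

import Mathlib

open MeasureTheory

/-- A randomized streaming algorithm over the universe `[U]` (represented by `Fin U`). Its memory
is a string of bits. All random choices, including fresh coins tossed at each time step, are given
by the sample point `ω : Ω`; the random choices and the current time are available to the algorithm
free of charge, and only the bits kept in memory between two updates count as space. -/
structure StreamingAlgorithm (Ω : Type*) (U : ℕ) where
  /-- the memory before the first item arrives -/
  init : Ω → List Bool
  /-- the new memory, when an item arrives after `t` earlier items -/
  update : Ω → (t : ℕ) → List Bool → Fin U → List Bool
  /-- the answer to a query made after `t` items have arrived -/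
  output : Ω → (t : ℕ) → List Bool → ℝ

namespace StreamingAlgorithm

variable {Ω : Type*} {U : ℕ}

/-- The memory after the first `t` items `x 0, …, x (t - 1)` of the stream `x`. -/
def memory (A : StreamingAlgorithm Ω U) (ω : Ω) (x : ℕ → Fin U) : ℕ → List Bool
  | 0 => A.init ω
  | t + 1 => A.update ω t (A.memory ω x t) (x t)

/-- The answer of the algorithm to a query made after the first `t` items of the stream `x`. -/
def estimate (A : StreamingAlgorithm Ω U) (ω : Ω) (x : ℕ → Fin U) (t : ℕ) : ℝ :=
  A.output ω t (A.memory ω x t)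

end StreamingAlgorithm

/-- The number of occurrences of `i` in the window of the `n` most recent of the first `t` items
of the stream `x` (used for `n ≤ t`). -/
def windowFreq {U : ℕ} (x : ℕ → Fin U) (n t : ℕ) (i : Fin U) : ℕ :=
  ((Finset.Ico (t - n) t).filter (fun j => x j = i)).card

/-- The `F_p` moment of that window. -/
noncomputable def windowMoment {U : ℕ} (p : ℝ) (x : ℕ → Fin U) (n t : ℕ) : ℝ :=
  ∑ i : Fin U, (windowFreq x n t i : ℝ) ^ p

namespace StreamingAlgorithm

variable {Ω : Type*} [MeasurableSpace Ω] {U : ℕ}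

/-- On streams of length `m`, for each fixed window of size `n`, the algorithm outputs a `1 ± ε`
approximation of the `F_p` moment of the window, except with probability at most `δ`. -/
def ApproximatesMoment (A : StreamingAlgorithm Ω U) (μ : Measure Ω) (p : ℝ) (n m : ℕ)
    (ε δ : ℝ) : Prop :=
  ∀ (x : ℕ → Fin U) (t : ℕ), n ≤ t → t ≤ m →
    μ {ω | A.estimate ω x t ∉
      Set.Icc ((1 - ε) * windowMoment p x n t) ((1 + ε) * windowMoment p x n t)}
      ≤ ENNReal.ofReal δ

/-- On every stream of length `m`, at every time, the algorithm's memory almost surely consists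
of at most `s` bits. -/
def UsesSpaceAtMost (A : StreamingAlgorithm Ω U) (μ : Measure Ω) (m s : ℕ) : Prop :=
  ∀ (x : ℕ → Fin U) (t : ℕ), t ≤ m → ∀ᵐ ω ∂μ, (A.memory ω x t).length ≤ s

end StreamingAlgorithm

/-! The memory is shown to encode a long message. With `K = k * t` and `t` about `r / 5`, the stream
consists of a header, `K` blocks of `2 ^ β ≤ N` slots each, and filler whose items recur with period
`n`. In block `q`, item `q` fills the one slot whose number is the message's `q`-th symbol. Run
lengths grow by a factor of 32 every `k` blocks, and longer blocks come first.

To probe block `h`, the stream continues with about `k ^ (1 / p) * len h` copies of item `h`, and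
the query is timed so that the window opens at the start of slot `c`. Longer blocks have then
expired, shorter ones contribute a fixed amount, and the run in block `h` survives exactly if `c` is
at most the symbol. By convexity its survival raises the moment by about `k ^ (1 - 1 / p) * (len h)
^ p`. The whole moment is `O(k * (len h) ^ p)`, by the geometric growth and the lower bound on `n`,
so a relative error `1 / (12 * k ^ (1 / p))` cannot hide the difference (`moment_gap`).

Binary search over `c` reads each symbol digit by digit. Fixing good coins, the memory at the end of
the blocks together with the pattern of wrong answers determines the message
(`mul_le_three_mul_space`). On average at most a tenth of the answers are wrong, and a weighted
count gives `K * β ≤ 3 * s` (`card_le_three_mul_of_error_correcting`). -/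

/-! ### Counting messages recoverable up to errors -/

/-- The lists of bits of length at most `s`. -/
def boolListsUpTo (s : ℕ) : Finset (List Bool) :=
  (Finset.range (s + 1)).biUnion fun i =>
    Finset.univ.image fun v : List.Vector Bool i => v.toList

theorem mem_boolListsUpTo {s : ℕ} {l : List Bool} (h : l.length ≤ s) : l ∈ boolListsUpTo s := by
  simp only [boolListsUpTo, Finset.mem_biUnion, Finset.mem_range, Finset.mem_image,
    Finset.mem_univ, true_and]
  exact ⟨l.length, by omega, ⟨l, rfl⟩, rfl⟩

theorem card_boolListsUpTo_lt (s : ℕ) : (boolListsUpTo s).card < 2 ^ (s + 1) := by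
  calc (boolListsUpTo s).card
      ≤ ∑ i ∈ Finset.range (s + 1),
          (Finset.univ.image fun v : List.Vector Bool i => v.toList).card := Finset.card_biUnion_le
    _ ≤ ∑ i ∈ Finset.range (s + 1), 2 ^ i := by
        refine Finset.sum_le_sum fun i _ => Finset.card_image_le.trans ?_
        simp [Finset.card_univ, card_vector]
    _ < 2 ^ (s + 1) := Nat.geomSum_lt le_rfl fun i hi => Finset.mem_range.1 hi

/-- By injectivity, distinct messages give distinct pairs, so the sum is dominated by the sum over
all of `T` times all error patterns, which factors over the positions. -/
theorem sum_prod_error_weights_le {Z ι α : Type*} [Fintype Z] [Fintype ι]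
    (T : Finset α) (M : Z → α) (hM : ∀ z, M z ∈ T) (err : Z → ι → Bool)
    (hinj : Function.Injective fun z => (M z, err z)) {x : ℝ} (hx : 0 ≤ x) :
    ∑ z, ∏ i, (if err z i then x else 1) ≤ T.card * (1 + x) ^ Fintype.card ι := by
  classical
  have h1 : ∑ z, ∏ i, (if err z i then x else 1) =
      ∑ y ∈ Finset.univ.image (fun z => (M z, err z)), ∏ i, (if y.2 i then x else 1) := by
    rw [Finset.sum_image fun a _ b _ h => hinj h]
  have h2 : ∑ y ∈ Finset.univ.image (fun z => (M z, err z)), ∏ i, (if y.2 i then x else 1) ≤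
      ∑ y ∈ T ×ˢ (Finset.univ : Finset (ι → Bool)), ∏ i, (if y.2 i then x else 1) := by
    refine Finset.sum_le_sum_of_subset_of_nonneg ?_ fun y _ _ =>
      Finset.prod_nonneg fun i _ => by split_ifs <;> positivity
    intro y hy
    obtain ⟨z, -, rfl⟩ := Finset.mem_image.1 hy
    simp [hM z]
  have h3 : ∑ e : ι → Bool, ∏ i, (if e i then x else 1) = (1 + x) ^ Fintype.card ι := by
    have := Finset.prod_univ_sum (fun _ : ι => (Finset.univ : Finset Bool))
      (fun _ b => if b then x else (1 : ℝ))
    rw [Fintype.piFinset_univ] at this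
    rw [← this]
    simp [Finset.card_univ, add_comm]
  rw [h1]
  refine h2.trans_eq ?_
  rw [Finset.sum_product, Finset.sum_congr rfl fun _ _ => h3, Finset.sum_const, nsmul_eq_mul]

/-- An encoding by at most `s` bits that, together with an error pattern of average weight at most
a tenth of the number of positions, determines one of `2 ^ D` messages, has `D ≤ 3 s`. -/
theorem card_le_three_mul_of_error_correcting {Z ι : Type*} [Fintype Z] [Fintype ι] {s : ℕ}
    (M : Z → List Bool) (hM : ∀ z, (M z).length ≤ s) (err : Z → ι → Bool)
    (hinj : Function.Injective fun z => (M z, err z)) (hZ : Fintype.card Z = 2 ^ Fintype.card ι)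
    (hav : ∑ z, ∑ i, (if err z i then (1 : ℝ) else 0) ≤ Fintype.card Z * (Fintype.card ι / 10)) :
    Fintype.card ι ≤ 3 * s := by
  set D := Fintype.card ι
  set m : ℝ := (D : ℝ) / 10
  set T := boolListsUpTo s
  have h8 : (0 : ℝ) < 8 := by norm_num
  have hup := sum_prod_error_weights_le T M (fun z => mem_boolListsUpTo (hM z)) err hinj
    (x := (1 / 8 : ℝ)) (by norm_num)
  -- Tangent line of the convex function `8 ^ (-E)` at `E = m`: after summation over `z`, only the
  -- average number of errors matters.
  have hlow : ∀ z, (8 : ℝ) ^ (-m) *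
      (1 + (m - ∑ i, (if err z i then (1 : ℝ) else 0)) * Real.log 8) ≤
      ∏ i, (if err z i then (1 / 8 : ℝ) else 1) := by
    intro z
    set E := ∑ i, (if err z i then (1 : ℝ) else 0)
    have hE : ∏ i, (if err z i then (1 / 8 : ℝ) else 1) = (8 : ℝ) ^ (-E) := by
      rw [← Finset.sum_neg_distrib, Real.rpow_sum_of_pos h8]
      refine Finset.prod_congr rfl fun i _ => ?_
      split_ifs <;> simp [Real.rpow_neg]
    rw [hE, show -E = -m + (m - E) by ring, Real.rpow_add h8]
    refine mul_le_mul_of_nonneg_left ?_ (by positivity)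
    rw [Real.rpow_def_of_pos h8]
    have := Real.add_one_le_exp (Real.log 8 * (m - E))
    linarith
  have hsum : (Fintype.card Z : ℝ) * (8 : ℝ) ^ (-m) ≤
      ∑ z, ∏ i, (if err z i then (1 / 8 : ℝ) else 1) := by
    refine le_trans ?_ (Finset.sum_le_sum fun z _ => hlow z)
    rw [← Finset.mul_sum, Finset.sum_add_distrib, ← Finset.sum_mul, Finset.sum_sub_distrib]
    simp only [Finset.sum_const, Finset.card_univ, nsmul_eq_mul, mul_one]
    rw [mul_comm]
    refine mul_le_mul_of_nonneg_left ?_ (by positivity)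
    have : 0 ≤ ((Fintype.card Z : ℝ) * m - ∑ z, ∑ i, (if err z i then (1 : ℝ) else 0)) *
      Real.log 8 := mul_nonneg (sub_nonneg.2 hav) (Real.log_nonneg (by norm_num))
    linarith
  have hmain : (2 : ℝ) ^ D * (8 : ℝ) ^ (-m) ≤ T.card * (9 / 8) ^ D := by
    have := hsum.trans hup
    rw [hZ] at this
    norm_num at this ⊢
    exact this
  have hsq : (2 : ℝ) ^ D ≤ (T.card : ℝ) ^ 2 := by
    have e1 : ((8 : ℝ) ^ (-m)) ^ 10 = ((1 / 8 : ℝ)) ^ D := by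
      rw [← Real.rpow_natCast, ← Real.rpow_mul h8.le]
      rw [show -m * ((10 : ℕ) : ℝ) = -(D : ℝ) by simp only [m]; push_cast; ring,
        Real.rpow_neg h8.le, Real.rpow_natCast, one_div, inv_pow]
    have h10 := pow_le_pow_left₀ (by positivity) hmain 10
    rw [mul_pow, mul_pow, e1, ← pow_mul, ← pow_mul, mul_comm D 10, pow_mul, pow_mul,
      ← mul_pow] at h10
    -- Tenth powers clear the exponent `D / 10`; the numerical fact is `32 * (9 / 8) ^ 10 ≤ 128`.
    have h32 : ((2 : ℝ) ^ 5) ^ D * ((9 / 8 : ℝ) ^ 10) ^ D ≤ ((2 : ℝ) ^ 10 * (1 / 8)) ^ D := by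
      rw [← mul_pow]
      exact pow_le_pow_left₀ (by positivity) (by norm_num) _
    have hpos : (0 : ℝ) < ((9 / 8 : ℝ) ^ 10) ^ D := by positivity
    have h5 : ((2 : ℝ) ^ D) ^ 5 ≤ ((T.card : ℝ) ^ 2) ^ 5 := by
      rw [← pow_mul, ← pow_mul, mul_comm D 5, pow_mul]
      exact le_of_mul_le_mul_right (h32.trans h10) hpos
    exact le_of_pow_le_pow_left₀ (by norm_num) (by positivity) h5
  have hT : T.card < 2 ^ (s + 1) := card_boolListsUpTo_lt s
  have hsq' : 2 ^ D ≤ T.card ^ 2 := by exact_mod_cast hsq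
  have hlt : 2 ^ D < 2 ^ (2 * (s + 1)) := by
    rw [mul_comm 2, pow_mul]
    exact hsq'.trans_lt (Nat.pow_lt_pow_left hT (by norm_num))
  have hD := (Nat.pow_lt_pow_iff_right (by norm_num)).1 hlt
  -- So far `D ≤ 2 * s + 1`, which is at most `3 * s` only for `s ≥ 1`.
  rcases Nat.eq_zero_or_pos s with rfl | hs
  · have : T.card ≤ 1 := by simpa using Nat.le_of_lt_succ hT
    have h1 : 2 ^ D ≤ 1 := hsq'.trans (by nlinarith)
    have : D = 0 := by
      by_contra hne
      exact absurd h1 (not_le.2 (Nat.one_lt_two_pow hne))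
    omega
  · omega

/-- Averaging over the sample space: some good sample point lies in few of finitely many events of
small outer measure. -/
theorem exists_sum_indicator_le {Ω A : Type*} [MeasurableSpace Ω] [Fintype A] (μ : Measure Ω)
    [IsProbabilityMeasure μ] (B : A → Set Ω) {δ : ℝ} (hδ : 0 ≤ δ)
    (hB : ∀ a, μ (B a) ≤ ENNReal.ofReal δ) {P : Ω → Prop} (hP : ∀ᵐ ω ∂μ, P ω) :
    ∃ ω, P ω ∧ ∑ a, (B a).indicator (fun _ => (1 : ℝ)) ω ≤ Fintype.card A * δ := by
  classical
  -- Measurable hulls are used because the events need not be measurable.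
  let f : Ω → ENNReal := fun ω => ∑ a, (toMeasurable μ (B a)).indicator 1 ω
  have hf : Measurable f := Finset.measurable_fun_sum _ fun a _ =>
    measurable_one.indicator (measurableSet_toMeasurable μ (B a))
  obtain ⟨ω, hω, hle⟩ := exists_notMem_null_le_lintegral (μ := μ) (f := f) hf.aemeasurable hP
  refine ⟨ω, not_not.1 hω, ?_⟩
  have hint : ∫⁻ ω, f ω ∂μ ≤ ENNReal.ofReal (Fintype.card A * δ) := by
    rw [lintegral_finsetSum _ fun a _ =>
      measurable_one.indicator (measurableSet_toMeasurable μ (B a))]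
    calc ∑ a, ∫⁻ ω, (toMeasurable μ (B a)).indicator 1 ω ∂μ
        = ∑ a, μ (B a) := Finset.sum_congr rfl fun a _ => by
          rw [lintegral_indicator_one (measurableSet_toMeasurable μ (B a)), measure_toMeasurable]
      _ ≤ ∑ _a : A, ENNReal.ofReal δ := Finset.sum_le_sum fun a _ => hB a
      _ = _ := by
          rw [Finset.sum_const, Finset.card_univ, nsmul_eq_mul,
            ENNReal.ofReal_mul (by positivity), ENNReal.ofReal_natCast]
  have hcmp : ENNReal.ofReal (∑ a, (B a).indicator (fun _ => (1 : ℝ)) ω) ≤ f ω := by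
    rw [ENNReal.ofReal_sum_of_nonneg fun a _ => Set.indicator_nonneg (fun _ _ => zero_le_one) _]
    refine Finset.sum_le_sum fun a _ => ?_
    by_cases h : ω ∈ B a
    · simp [h, subset_toMeasurable μ (B a) h]
    · simp [h]
  exact (ENNReal.ofReal_le_ofReal_iff (by positivity)).1 (hcmp.trans (hle.trans hint))

/-! ### Moment estimates -/

/-- The amount by which an item of frequency `f` raises the `F_p` moment above the `F_1` moment. -/
noncomputable def momentExcess (p : ℝ) (f : ℕ) : ℝ := (f : ℝ) ^ p - f

theorem momentExcess_zero {p : ℝ} (hp : 1 < p) : momentExcess p 0 = 0 := by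
  simp [momentExcess, Real.zero_rpow (by linarith : p ≠ 0)]

theorem momentExcess_one (p : ℝ) : momentExcess p 1 = 0 := by simp [momentExcess]

theorem momentExcess_le (p : ℝ) (f : ℕ) : momentExcess p f ≤ (f : ℝ) ^ p :=
  sub_le_self _ (Nat.cast_nonneg f)

/-- Tangent-line bound for the increments of `x ↦ x ^ p`. -/
theorem rpow_add_mul_le_rpow_add {p B l : ℝ} (hp : 1 ≤ p) (hB : 0 < B) (hl : 0 ≤ l) :
    B ^ p + p * B ^ (p - 1) * l ≤ (B + l) ^ p := by
  have h := one_add_mul_self_le_rpow_one_add (s := l / B) (by linarith [div_nonneg hl hB.le]) hp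
  have e : (B + l) ^ p = B ^ p * (1 + l / B) ^ p := by
    rw [← Real.mul_rpow hB.le (by positivity)]
    congr 1
    field_simp
  have e2 : B ^ p = B ^ (p - 1) * B := by
    conv_rhs => rw [← Real.rpow_add_one hB.ne']
    ring_nf
  rw [e]
  calc B ^ p + p * B ^ (p - 1) * l = B ^ p * (1 + p * (l / B)) := by
        rw [e2]; field_simp
    _ ≤ _ := mul_le_mul_of_nonneg_left h (by positivity)

/-- In units of `k * w ^ p` with `w = l + 1`, the two moments compared in `moment_gap` total at most
`5 + 2 * δ + 48 / 23`: 2 from `n` twice, 1 and `2 + 2 * δ` from the probed item, `48 / 23` from `T`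
twice. The square bounds `(w / l) ^ p`; the right side is the gain from the run, times 12. -/
theorem gap_polynomial_lt {δ : ℝ} (h0 : 0 ≤ δ) (h1 : δ ≤ 1) :
    (5 + 2 * δ + 48 / 23) * (1 + δ / 3) ^ 2 < 12 * (1 + δ - 5 / 16) := by
  have h2 : δ ^ 2 ≤ δ := by nlinarith
  have h3 : δ ^ 3 ≤ δ := by nlinarith
  ring_nf
  linarith

/-- With `b ≈ k ^ (1 / p) * l` probing copies, an additional run of `l` copies of the probed item
changes the moment by more than what the approximation guarantee permits. -/
theorem moment_gap {p n T : ℝ} {k l b : ℕ} (hp1 : 1 < p) (hp2 : p ≤ 2) (hk : 1 ≤ k)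
    (hl : 3 / (p - 1) ≤ l) (hlp : (16 / 5 : ℝ) ≤ (l : ℝ) ^ (p - 1))
    (hb : b = ⌊(k : ℝ) ^ (1 / p) * l⌋₊) (hn : n ≤ k * ((l : ℝ) + 1) ^ p)
    (hT : T ≤ 24 / 23 * (k * ((l : ℝ) + 1) ^ p)) :
    (1 + 1 / (12 * (k : ℝ) ^ (1 / p))) * (n + momentExcess p (1 + b) + T) <
      (1 - 1 / (12 * (k : ℝ) ^ (1 / p))) * (n + momentExcess p (1 + b + l) + T) := by
  set κ : ℝ := (k : ℝ) ^ (1 / p) with hκ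
  set δ : ℝ := p - 1 with hδ
  have hδ0 : 0 < δ := by linarith
  have hp0 : 0 < p := by linarith
  have hk1 : (1 : ℝ) ≤ k := by exact_mod_cast hk
  have hκ1 : 1 ≤ κ := Real.one_le_rpow hk1 (by positivity)
  have hκ0 : 0 < κ := by linarith
  have hκp : κ ^ p = k := by
    rw [hκ, ← Real.rpow_mul (by positivity), one_div_mul_cancel hp0.ne', Real.rpow_one]
  set v : ℝ := κ ^ δ with hv
  have hv1 : 1 ≤ v := Real.one_le_rpow hκ1 hδ0.le
  have hkv : (k : ℝ) = v * κ := by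
    rw [← hκp, hv, ← Real.rpow_add_one hκ0.ne']
    congr 1
    simp [hδ]
  have hl3 : 3 ≤ δ * l := by
    rw [div_le_iff₀ hδ0] at hl; linarith
  have hl1 : (3 : ℝ) ≤ l := by nlinarith
  have hl0 : (0 : ℝ) < l := by linarith
  set lam : ℝ := (l : ℝ) with hlam
  set w : ℝ := lam + 1 with hw
  set B : ℝ := 1 + (b : ℝ) with hBdef
  have hBl : κ * lam ≤ B := by
    have := Nat.lt_floor_add_one (κ * lam)
    rw [← hb] at this; linarith
  have hBu : B ≤ κ * w := by
    have := Nat.floor_le (a := κ * lam) (by positivity)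
    rw [← hb] at this
    rw [hBdef, hw]; nlinarith
  have hB0 : 0 < B := by positivity
  have hw0 : 0 < w := by positivity
  have hlamp : lam ^ p = lam ^ δ * lam := by
    rw [← Real.rpow_add_one hl0.ne']
    congr 1
    simp [hδ]
  -- The linear term subtracted in the excess costs at most `5 / 16` of `lam ^ p`.
  have hlin : lam ≤ 5 / 16 * lam ^ p := by rw [hlamp]; nlinarith
  have hlp0 : 0 < lam ^ p := by positivity
  have hdiff : B ^ p + v * lam ^ p * (p - 5 / 16) ≤ (B + lam) ^ p - lam := by
    have h1 := rpow_add_mul_le_rpow_add hp1.le hB0 hl0.le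
    have h2 : v * lam ^ δ ≤ B ^ (p - 1) := by
      rw [hv, ← Real.mul_rpow hκ0.le hl0.le]
      exact Real.rpow_le_rpow (by positivity) hBl hδ0.le
    have h3 : p * (v * lam ^ δ) * lam ≤ p * B ^ (p - 1) * lam := by gcongr
    have h4 : v * lam ≤ v * (5 / 16 * lam ^ p) := by gcongr
    have h5 : lam ≤ v * lam := le_mul_of_one_le_left hl0.le hv1
    rw [hlamp] at h4 ⊢
    nlinarith
  have hBp : B ^ p ≤ k * w ^ p := by
    rw [← hκp, ← Real.mul_rpow hκ0.le hw0.le]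
    exact Real.rpow_le_rpow hB0.le hBu hp0.le
  -- Bernoulli with exponent `δ ≤ 1`: `2 ^ δ ≤ 1 + δ`.
  have h2p : (2 : ℝ) ^ p ≤ 2 * p := by
    have h := rpow_one_add_le_one_add_mul_self (s := 1) (by norm_num) hδ0.le
      (by linarith : δ ≤ 1)
    have e : (2 : ℝ) ^ p = 2 ^ δ * 2 := by
      rw [← Real.rpow_add_one (by norm_num)]
      congr 1
      simp [hδ]
    rw [e]
    norm_num at h
    linarith
  have hBlp : (B + lam) ^ p ≤ 2 * p * (k * w ^ p) := by
    calc (B + lam) ^ p ≤ (2 * (κ * w)) ^ p :=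
          Real.rpow_le_rpow (by positivity) (by nlinarith) hp0.le
      _ = 2 ^ p * (k * w ^ p) := by
          rw [Real.mul_rpow (by norm_num) (by positivity), Real.mul_rpow hκ0.le hw0.le, hκp]
      _ ≤ _ := by gcongr
  have hwp : w ^ p ≤ lam ^ p * (1 + δ / 3) ^ 2 := by
    have h1 : w ≤ lam * (1 + δ / 3) := by rw [hw]; nlinarith
    calc w ^ p ≤ (lam * (1 + δ / 3)) ^ p := Real.rpow_le_rpow hw0.le h1 hp0.le
      _ = lam ^ p * (1 + δ / 3) ^ p := Real.mul_rpow hl0.le (by positivity)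
      _ ≤ _ := by
          gcongr
          have := Real.rpow_le_rpow_of_exponent_le (x := 1 + δ / 3) (by linarith) hp2
          exact this.trans_eq (by norm_cast)
  have hin : momentExcess p (1 + b + l) = (B + lam) ^ p - (B + lam) := by
    simp only [momentExcess, hBdef, hlam]; push_cast; ring_nf
  have hout : momentExcess p (1 + b) = B ^ p - B := by
    simp only [momentExcess, hBdef]; push_cast; ring_nf
  rw [hin, hout]
  have hpoly := gap_polynomial_lt hδ0.le (by linarith : δ ≤ 1)
  rw [show 1 + δ = p by simp [hδ]] at hpoly
  have hsum : (n + (B ^ p - B) + T) + (n + ((B + lam) ^ p - (B + lam)) + T) ≤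
      (5 + 2 * δ + 48 / 23) * (k * w ^ p) := by
    have e : p = 1 + δ := by simp [hδ]
    have : 2 * p * (k * w ^ p) = (2 + 2 * δ) * (k * w ^ p) := by rw [e]; ring
    linarith
  have hfin : 1 / (12 * κ) * ((n + (B ^ p - B) + T) + (n + ((B + lam) ^ p - (B + lam)) + T)) <
      v * lam ^ p * (p - 5 / 16) := by
    calc _ ≤ 1 / (12 * κ) * ((5 + 2 * δ + 48 / 23) * (k * w ^ p)) := by gcongr
      _ = v / 12 * ((5 + 2 * δ + 48 / 23) * w ^ p) := by rw [hkv]; field_simp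
      _ ≤ v / 12 * ((5 + 2 * δ + 48 / 23) * (lam ^ p * (1 + δ / 3) ^ 2)) := by gcongr
      _ = v * lam ^ p / 12 * ((5 + 2 * δ + 48 / 23) * (1 + δ / 3) ^ 2) := by ring
      _ < v * lam ^ p / 12 * (12 * (p - 5 / 16)) := by gcongr
      _ = _ := by ring
  linarith

/-- The base run length `l` obtained by rounding down `n / (Γ k)`. -/
theorem base_run_length_bounds {p : ℝ} {n k Γ : ℕ} (hp1 : 1 < p) (hp2 : p ≤ 2) (hk : 1 ≤ k)
    (hΓ : 4 ≤ Γ) (hn : (Γ : ℝ) * (k : ℝ) ^ (1 - 1 / p) ≤ (n : ℝ) ^ (1 - 1 / p)) :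
    3 / (p - 1) ≤ ((n / (Γ * k) : ℕ) : ℝ) ∧ (16 / 5 : ℝ) ≤ ((n / (Γ * k) : ℕ) : ℝ) ^ (p - 1) ∧
      (n : ℝ) ≤ k * (((n / (Γ * k) : ℕ) : ℝ) + 1) ^ p ∧ Γ ≤ n / (Γ * k) := by
  have hp0 : 0 < p := by linarith
  set δ : ℝ := p - 1 with hδ
  have hδ0 : 0 < δ := by linarith
  have hk0 : (0 : ℝ) < k := by exact_mod_cast hk
  have hΓ4 : (4 : ℝ) ≤ Γ := by exact_mod_cast hΓ
  have hΓ0 : (0 : ℝ) < Γ := by linarith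
  set y : ℝ := n / (Γ * k) with hy
  have hy0 : 0 ≤ y := by positivity
  have hny : (n : ℝ) = k * (Γ * y) := by rw [hy]; field_simp
  have hexp : (1 - 1 / p) * p = δ := by rw [hδ]; field_simp
  have hq0 : 0 < 1 - 1 / p := by
    have : 1 / p < 1 := by rw [div_lt_one hp0]; exact hp1
    linarith
  have h1 : (Γ : ℝ) ≤ (Γ * y) ^ (1 - 1 / p) := by
    rw [hny, Real.mul_rpow hk0.le (by positivity), mul_comm] at hn
    exact le_of_mul_le_mul_left hn (by positivity)
  have h2 : (Γ : ℝ) ^ p ≤ (Γ * y) ^ δ := by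
    rw [← hexp, Real.rpow_mul (by positivity)]
    exact Real.rpow_le_rpow hΓ0.le h1 hp0.le
  -- This form of the hypothesis on `n` drives all four bounds.
  have h3 : (Γ : ℝ) ≤ y ^ δ := by
    rw [Real.mul_rpow hΓ0.le hy0] at h2
    have e : (Γ : ℝ) ^ p = Γ ^ δ * Γ := by
      rw [← Real.rpow_add_one hΓ0.ne']
      congr 1
      simp [hδ]
    rw [e] at h2
    exact le_of_mul_le_mul_left h2 (by positivity)
  have hypos : 0 < y := by
    rcases hy0.eq_or_lt with h | h
    · rw [← h, Real.zero_rpow hδ0.ne'] at h3; linarith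
    · exact h
  have h4 : (Γ : ℝ) ^ (1 / δ) ≤ y := by
    have := Real.rpow_le_rpow hΓ0.le h3 (by positivity : 0 ≤ 1 / δ)
    rwa [← Real.rpow_mul hy0, mul_one_div_cancel hδ0.ne', Real.rpow_one] at this
  have hd1 : 1 ≤ 1 / δ := by rw [le_div_iff₀ hδ0]; linarith
  -- Bernoulli applied to `4 ^ (1 / δ)`; the summand 1 pays for the floor.
  have h5 : 1 + 3 / δ ≤ y := by
    have := one_add_mul_self_le_rpow_one_add (s := 3) (by norm_num) hd1
    have h6 : (1 + 3 : ℝ) ^ (1 / δ) ≤ Γ ^ (1 / δ) :=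
      Real.rpow_le_rpow (by norm_num) (by linarith) (by positivity)
    calc 1 + 3 / δ = 1 + 1 / δ * 3 := by ring
      _ ≤ _ := this.trans (h6.trans h4)
  have hΓy : (Γ : ℝ) ≤ y := by
    refine le_trans ?_ h4
    have := Real.rpow_le_rpow_of_exponent_le (x := (Γ : ℝ)) (by linarith) hd1
    rwa [Real.rpow_one] at this
  have hfl : n / (Γ * k) = ⌊y⌋₊ := by
    rw [hy, ← Nat.cast_mul, Nat.floor_div_eq_div]
  rw [hfl]
  have hlt := Nat.lt_floor_add_one y
  have hle := Nat.floor_le hy0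
  have hΓf : Γ ≤ ⌊y⌋₊ := Nat.le_floor hΓy
  have hf4 : (4 : ℝ) ≤ (⌊y⌋₊ : ℝ) := by exact_mod_cast hΓ.trans hΓf
  refine ⟨by linarith, ?_, ?_, hΓf⟩
  -- A floor that is at least 4 loses at most a fifth of `y`.
  · have h7 : (4 / 5 : ℝ) * y ≤ (⌊y⌋₊ : ℝ) := by linarith
    have h8 := Real.rpow_le_rpow (by positivity) h7 hδ0.le
    rw [Real.mul_rpow (by norm_num) hy0] at h8
    have h9 : (4 / 5 : ℝ) ≤ (4 / 5 : ℝ) ^ δ := by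
      have := Real.rpow_le_rpow_of_exponent_ge (x := (4 / 5 : ℝ)) (by norm_num) (by norm_num)
        (by linarith : δ ≤ 1)
      rwa [Real.rpow_one] at this
    calc (16 / 5 : ℝ) = 4 / 5 * 4 := by norm_num
      _ ≤ (4 / 5) ^ δ * y ^ δ := by gcongr; linarith
      _ ≤ _ := h8
  · rw [hny]
    refine mul_le_mul_of_nonneg_left ?_ hk0.le
    calc (Γ : ℝ) * y ≤ y ^ δ * y := by gcongr
      _ = y ^ p := by
          rw [← Real.rpow_add_one hypos.ne']
          congr 1
          simp [hδ]
      _ ≤ _ := Real.rpow_le_rpow hy0 hlt.le hp0.le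

/-! ### Overlaid streams and their windows -/

/-- The stream that cycles through `0, …, n - 1`, except that item `q < K` is placed at the
positions in `R q`. -/
noncomputable def overlayItem (n K : ℕ) (R : ℕ → Finset ℕ) (t : ℕ) : ℕ :=
  open Classical in if h : ∃ q, q < K ∧ t ∈ R q then Nat.find h else t % n

section Overlay

variable {n K : ℕ} {R : ℕ → Finset ℕ}

theorem overlayItem_of_mem (hdis : ∀ q < K, ∀ q' < K, q ≠ q' → Disjoint (R q) (R q'))
    {q t : ℕ} (hq : q < K) (ht : t ∈ R q) : overlayItem n K R t = q := by
  classical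
  have h : ∃ q, q < K ∧ t ∈ R q := ⟨q, hq, ht⟩
  rw [overlayItem, dif_pos h]
  by_contra hne
  obtain ⟨h1, h2⟩ := Nat.find_spec h
  refine Finset.disjoint_left.1 (hdis _ h1 _ hq ?_) h2 ht
  convert hne

theorem overlayItem_of_notMem {t : ℕ} (ht : ∀ q < K, t ∉ R q) : overlayItem n K R t = t % n := by
  rw [overlayItem, dif_neg]
  rintro ⟨q, hq, h⟩
  exact ht q hq h

theorem overlayItem_lt (hn : 0 < n) (hK : K ≤ n) (t : ℕ) : overlayItem n K R t < n := by
  classical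
  by_cases h : ∃ q, q < K ∧ t ∈ R q
  · rw [overlayItem, dif_pos h]
    exact (Nat.find_spec h).1.trans_le hK
  · rw [overlayItem, dif_neg h]
    exact Nat.mod_lt _ hn

theorem overlayItem_congr {R' : ℕ → Finset ℕ} {t : ℕ} (h : ∀ q < K, t ∈ R q ↔ t ∈ R' q) :
    overlayItem n K R t = overlayItem n K R' t := by
  have : (fun q => q < K ∧ t ∈ R q) = fun q => q < K ∧ t ∈ R' q := by
    funext q
    exact propext (and_congr_right (h q))
  unfold overlayItem
  simp only [this]

/-- As `K ≤ s`, the header has left the window, so the filler copy of `v` that it contains is the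
one at `n + v`, beyond all overlaid positions. -/
theorem filter_overlayItem_of_lt (hdis : ∀ q < K, ∀ q' < K, q ≠ q' → Disjoint (R q) (R q'))
    (hR : ∀ q < K, ∀ t ∈ R q, t < n) {s v : ℕ} (hs : K ≤ s) (hsn : s ≤ n) (hv : v < K) :
    (Finset.Ico s (s + n)).filter (fun j => overlayItem n K R j = v) =
      insert (n + v) ((R v).filter (s ≤ ·)) := by
  ext j
  simp only [Finset.mem_filter, Finset.mem_Ico, Finset.mem_insert]
  constructor
  · rintro ⟨⟨h1, h2⟩, h3⟩
    by_cases h : ∃ q, q < K ∧ j ∈ R q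
    · obtain ⟨q, hq, hj⟩ := h
      rw [overlayItem_of_mem hdis hq hj] at h3
      subst h3
      exact Or.inr ⟨hj, h1⟩
    · rw [overlayItem_of_notMem fun q hq hj => h ⟨q, hq, hj⟩] at h3
      left
      rcases lt_or_ge j n with hj | hj
      · rw [Nat.mod_eq_of_lt hj] at h3; omega
      · rw [Nat.mod_eq_sub_mod hj, Nat.mod_eq_of_lt (by omega)] at h3; omega
  · rintro (rfl | ⟨h1, h2⟩)
    · refine ⟨by omega, ?_⟩
      rw [overlayItem_of_notMem fun q hq hj => absurd (hR q hq _ hj) (by omega),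
        Nat.add_mod_left, Nat.mod_eq_of_lt (by omega)]
    · have := hR v hv j h1
      exact ⟨by omega, overlayItem_of_mem hdis hv h1⟩

theorem card_filter_overlayItem_of_lt
    (hdis : ∀ q < K, ∀ q' < K, q ≠ q' → Disjoint (R q) (R q'))
    (hR : ∀ q < K, ∀ t ∈ R q, t < n) {s v : ℕ} (hs : K ≤ s) (hsn : s ≤ n) (hv : v < K) :
    ((Finset.Ico s (s + n)).filter (fun j => overlayItem n K R j = v)).card =
      1 + ((R v).filter (s ≤ ·)).card := by
  rw [filter_overlayItem_of_lt hdis hR hs hsn hv, Finset.card_insert_of_notMem, add_comm]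
  intro h
  have := hR v hv _ (Finset.mem_filter.1 h).1
  omega

/-- Such an item occurs only as filler, and the `n` times in a window have distinct residues. Hence
it contributes no excess. -/
theorem card_filter_overlayItem_of_ge
    (hdis : ∀ q < K, ∀ q' < K, q ≠ q' → Disjoint (R q) (R q')) (s : ℕ) {v : ℕ} (hv : K ≤ v) :
    ((Finset.Ico s (s + n)).filter (fun j => overlayItem n K R j = v)).card ≤ 1 := by
  have key : ∀ j, overlayItem n K R j = v → j % n = v := by
    intro j hj
    rw [overlayItem_of_notMem] at hj
    · exact hj
    · intro q hq hjq
      rw [overlayItem_of_mem hdis hq hjq] at hj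
      omega
  refine Finset.card_le_one.2 fun i hi j hj => ?_
  simp only [Finset.mem_filter, Finset.mem_Ico] at hi hj
  obtain ⟨⟨hi1, hi2⟩, hi3⟩ := hi
  obtain ⟨⟨hj1, hj2⟩, hj3⟩ := hj
  have hm : i ≡ j [MOD n] := (key i hi3).trans (key j hj3).symm
  have h1 : i - s ≡ j - s [MOD n] := by
    refine Nat.ModEq.add_right_cancel' s ?_
    rwa [Nat.sub_add_cancel hi1, Nat.sub_add_cancel hj1]
  have := Nat.ModEq.eq_of_lt_of_lt h1 (by omega) (by omega)
  omega

theorem windowMoment_eq_add_sum_momentExcess {U : ℕ} (p : ℝ) (x : ℕ → Fin U) {n t : ℕ}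
    (ht : n ≤ t) :
    windowMoment p x n t = n + ∑ i, momentExcess p (windowFreq x n t i) := by
  have h : ∑ i, windowFreq x n t i = n := by
    have := Finset.card_eq_sum_card_fiberwise (s := Finset.Ico (t - n) t) (t := Finset.univ)
      (f := x) (fun _ _ => Finset.mem_coe.2 (Finset.mem_univ _))
    rw [Nat.card_Ico] at this
    simp only [windowFreq]
    omega
  have h' : ∑ i, (windowFreq x n t i : ℝ) = n := by exact_mod_cast h
  simp only [windowMoment, momentExcess, Finset.sum_sub_distrib, h']
  ring

/-- The overlaid stream, with items in `Fin U`. -/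
noncomputable def overlayStream {U : ℕ} (n K : ℕ) (hn : 0 < n) (hK : K ≤ n) (hU : n ≤ U)
    (R : ℕ → Finset ℕ) (t : ℕ) : Fin U :=
  ⟨overlayItem n K R t, (overlayItem_lt hn hK t).trans_le hU⟩

theorem windowMoment_overlayStream {U : ℕ} {p : ℝ} (hp : 1 < p) (hn : 0 < n) (hK : K ≤ n)
    (hU : n ≤ U) (hdis : ∀ q < K, ∀ q' < K, q ≠ q' → Disjoint (R q) (R q'))
    (hR : ∀ q < K, ∀ t ∈ R q, t < n) {s : ℕ} (hs : K ≤ s) (hsn : s ≤ n) :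
    windowMoment p (overlayStream n K hn hK hU R) n (s + n) =
      n + ∑ q ∈ Finset.range K, momentExcess p (1 + ((R q).filter (s ≤ ·)).card) := by
  rw [windowMoment_eq_add_sum_momentExcess p _ (Nat.le_add_left n s)]
  congr 1
  let g : ℕ → ℝ := fun v =>
    if v < K then momentExcess p (1 + ((R v).filter (s ≤ ·)).card) else 0
  have h1 : ∀ i : Fin U,
      momentExcess p (windowFreq (overlayStream n K hn hK hU R) n (s + n) i) = g i := by
    intro i
    have e : windowFreq (overlayStream n K hn hK hU R) n (s + n) i =
        ((Finset.Ico s (s + n)).filter (fun j => overlayItem n K R j = i)).card := by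
      simp only [windowFreq, overlayStream, Nat.add_sub_cancel, Fin.ext_iff]
    rw [e]
    by_cases hi : (i : ℕ) < K
    · simp only [g, if_pos hi, card_filter_overlayItem_of_lt hdis hR hs hsn hi]
    · simp only [g, if_neg hi]
      have := card_filter_overlayItem_of_ge (n := n) hdis s (not_lt.1 hi)
      rcases Nat.le_one_iff_eq_zero_or_eq_one.1 this with h | h <;> rw [h]
      · exact momentExcess_zero hp
      · exact momentExcess_one p
  rw [Finset.sum_congr rfl fun i _ => h1 i, Fin.sum_univ_eq_sum_range g U]
  rw [← Finset.sum_subset (Finset.range_mono (hK.trans hU))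
    (fun v _ hv => by simp only [g]; rw [if_neg]; simpa using hv)]
  exact Finset.sum_congr rfl fun q hq => if_pos (Finset.mem_range.1 hq)

end Overlay

/-! ### Dependence of the memory on the stream -/

namespace StreamingAlgorithm

theorem memory_eq_of_memory_eq {Ω : Type*} {U : ℕ} (A : StreamingAlgorithm Ω U) (ω : Ω)
    {x y : ℕ → Fin U} {L T : ℕ} (hLT : L ≤ T) (hL : A.memory ω x L = A.memory ω y L)
    (h : ∀ t, L ≤ t → t < T → x t = y t) : A.memory ω x T = A.memory ω y T := by
  induction T, hLT using Nat.le_induction with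
  | base => exact hL
  | succ T hT ih =>
    rw [memory, memory, ih fun t h1 h2 => h t h1 (by omega), h T hT (by omega)]

theorem memory_congr {Ω : Type*} {U : ℕ} (A : StreamingAlgorithm Ω U) (ω : Ω)
    {x y : ℕ → Fin U} {T : ℕ} (h : ∀ t < T, x t = y t) : A.memory ω x T = A.memory ω y T :=
  A.memory_eq_of_memory_eq ω (Nat.zero_le T) rfl fun t _ => h t

end StreamingAlgorithm

/-! ### Layout of the blocks -/

/-- The total length of the blocks `0, …, q - 1`, where block `i` has `2 ^ β` slots of width
`len i`. -/
def blockOffset (β : ℕ) (len : ℕ → ℕ) (q : ℕ) : ℕ := ∑ i ∈ Finset.range q, 2 ^ β * len i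

/-- The stream starts with `K` header items followed by the blocks `K - 1, …, 0`, in this order;
this is the position at which block `q` starts. -/
def blockStart (K β : ℕ) (len : ℕ → ℕ) (q : ℕ) : ℕ :=
  K + (blockOffset β len K - blockOffset β len (q + 1))

/-- The position at which item `q` starts to be repeated `b` times when block `h` is probed is
`K + blockOffset β len K`, the end of the blocks. Block `q` contains a run of item `q` that fills
its slot number `a q`. -/
def itemPositions (K β : ℕ) (len a : ℕ → ℕ) (h b q : ℕ) : Finset ℕ :=
  Finset.Ico (blockStart K β len q + a q * len q) (blockStart K β len q + (a q + 1) * len q) ∪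
    if q = h then Finset.Ico (K + blockOffset β len K) (K + blockOffset β len K + b) else ∅

section Layout

variable {K β : ℕ} {len a : ℕ → ℕ}

theorem blockOffset_mono : Monotone (blockOffset β len) := fun _ _ h =>
  Finset.sum_le_sum_of_subset (Finset.range_mono h)

theorem blockOffset_succ (q : ℕ) :
    blockOffset β len (q + 1) = blockOffset β len q + 2 ^ β * len q :=
  Finset.sum_range_succ _ _

theorem blockStart_add {q : ℕ} (hq : q < K) :
    blockStart K β len q + 2 ^ β * len q + blockOffset β len q = K + blockOffset β len K := by
  have h1 := blockOffset_succ (β := β) (len := len) q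
  have h2 := blockOffset_mono (β := β) (len := len) (Nat.succ_le_of_lt hq)
  simp only [Nat.succ_eq_add_one] at h2
  unfold blockStart
  omega

theorem blockStart_add_le_blockStart {q q' : ℕ} (h : q' < q) (hq : q < K) :
    blockStart K β len q + 2 ^ β * len q ≤ blockStart K β len q' := by
  have h1 := blockStart_add (β := β) (len := len) hq
  have h2 := blockStart_add (β := β) (len := len) (h.trans hq)
  have h3 := blockOffset_mono (β := β) (len := len) (Nat.succ_le_of_lt h)
  have h4 := blockOffset_succ (β := β) (len := len) q'
  simp only [Nat.succ_eq_add_one] at h3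
  omega

theorem mem_itemPositions {h b q t : ℕ} : t ∈ itemPositions K β len a h b q ↔
    (blockStart K β len q + a q * len q ≤ t ∧ t < blockStart K β len q + (a q + 1) * len q) ∨
      (q = h ∧ K + blockOffset β len K ≤ t ∧ t < K + blockOffset β len K + b) := by
  unfold itemPositions
  by_cases hq : q = h <;> simp [hq]

theorem slot_end_le (ha : ∀ q < K, a q < 2 ^ β) {q : ℕ} (hq : q < K) :
    (a q + 1) * len q ≤ 2 ^ β * len q :=
  Nat.mul_le_mul_right _ (ha q hq)

theorem disjoint_itemPositions (ha : ∀ q < K, a q < 2 ^ β) {h b : ℕ} :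
    ∀ q < K, ∀ q' < K, q ≠ q' →
      Disjoint (itemPositions K β len a h b q) (itemPositions K β len a h b q') := by
  have key : ∀ q < K, ∀ q' < q, ∀ t, t ∈ itemPositions K β len a h b q →
      t ∉ itemPositions K β len a h b q' := by
    intro q hq q' hq' t h1 h2
    rw [mem_itemPositions] at h1 h2
    have e1 := slot_end_le (len := len) ha hq
    have e2 := slot_end_le (len := len) ha (hq'.trans hq)
    have e3 := blockStart_add (β := β) (len := len) hq
    have e4 := blockStart_add (β := β) (len := len) (hq'.trans hq)
    have e5 := blockStart_add_le_blockStart (β := β) (len := len) hq' hq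
    have e6 : blockStart K β len q' ≤ blockStart K β len q' + a q' * len q' := Nat.le_add_right _ _
    omega
  intro q hq q' hq' hne
  rw [Finset.disjoint_left]
  rcases lt_or_gt_of_ne hne with h | h
  · exact fun t h1 h2 => key q' hq' q h t h2 h1
  · exact fun t h1 h2 => key q hq q' h t h1 h2

theorem lt_of_mem_itemPositions (ha : ∀ q < K, a q < 2 ^ β) {h b n : ℕ}
    (hn : K + blockOffset β len K + b ≤ n) :
    ∀ q < K, ∀ t ∈ itemPositions K β len a h b q, t < n := by
  intro q hq t ht
  rw [mem_itemPositions] at ht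
  have e1 := slot_end_le (len := len) ha hq
  have e3 := blockStart_add (β := β) (len := len) hq
  omega

/-- Blocks above `h` precede the window and those below lie inside it. A window opening at a slot
boundary never cuts the run in block `h`: it keeps all of it or nothing. Thus the message enters
only through the comparison of `c` with `a h`. -/
theorem card_filter_itemPositions (ha : ∀ q < K, a q < 2 ^ β) {h b c : ℕ} (hh : h < K)
    (hc : c ≤ 2 ^ β) {q : ℕ} (hq : q < K) :
    ((itemPositions K β len a h b q).filter (blockStart K β len h + c * len h ≤ ·)).card =
      if q < h then len q else if q = h then b + (if c ≤ a h then len h else 0) else 0 := by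
  have e1 := slot_end_le (len := len) ha hq
  have e2 := blockStart_add (β := β) (len := len) hq
  have e3 := blockStart_add (β := β) (len := len) hh
  have e4 : c * len h ≤ 2 ^ β * len h := Nat.mul_le_mul_right _ hc
  have e5 : (a q + 1) * len q = a q * len q + len q := by ring
  rcases lt_trichotomy q h with hlt | rfl | hgt
  · have e6 := blockStart_add_le_blockStart (β := β) (len := len) hlt hh
    rw [if_pos hlt]
    have : (itemPositions K β len a h b q).filter (blockStart K β len h + c * len h ≤ ·) =
        Finset.Ico (blockStart K β len q + a q * len q)
          (blockStart K β len q + (a q + 1) * len q) := by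
      ext t
      rw [Finset.mem_filter, mem_itemPositions, Finset.mem_Ico]
      omega
    rw [this, Nat.card_Ico]
    omega
  · rw [if_neg (lt_irrefl _), if_pos rfl]
    by_cases hca : c ≤ a q
    · have e6 : c * len q ≤ a q * len q := Nat.mul_le_mul_right _ hca
      rw [if_pos hca]
      have : (itemPositions K β len a q b q).filter (blockStart K β len q + c * len q ≤ ·) =
          Finset.Ico (blockStart K β len q + a q * len q)
            (blockStart K β len q + (a q + 1) * len q) ∪
          Finset.Ico (K + blockOffset β len K) (K + blockOffset β len K + b) := by
        ext t
        rw [Finset.mem_filter, mem_itemPositions, Finset.mem_union, Finset.mem_Ico,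
          Finset.mem_Ico]
        omega
      rw [this, Finset.card_union_of_disjoint, Nat.card_Ico, Nat.card_Ico]
      · omega
      · rw [Finset.disjoint_left]
        intro t h1 h2
        rw [Finset.mem_Ico] at h1 h2
        omega
    · have e6 : (a q + 1) * len q ≤ c * len q := Nat.mul_le_mul_right _ (not_le.1 hca)
      rw [if_neg hca]
      have : (itemPositions K β len a q b q).filter (blockStart K β len q + c * len q ≤ ·) =
          Finset.Ico (K + blockOffset β len K) (K + blockOffset β len K + b) := by
        ext t
        rw [Finset.mem_filter, mem_itemPositions, Finset.mem_Ico]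
        omega
      rw [this, Nat.card_Ico]
      omega
  · have e6 := blockStart_add_le_blockStart (β := β) (len := len) hgt hq
    rw [if_neg (by omega), if_neg (by omega), Finset.card_eq_zero, Finset.filter_eq_empty_iff]
    intro t ht
    rw [mem_itemPositions] at ht
    omega

theorem sum_momentExcess_itemPositions (p : ℝ) (ha : ∀ q < K, a q < 2 ^ β) {h b c : ℕ}
    (hh : h < K) (hc : c ≤ 2 ^ β) :
    ∑ q ∈ Finset.range K, momentExcess p (1 + ((itemPositions K β len a h b q).filter
        (blockStart K β len h + c * len h ≤ ·)).card) =
      momentExcess p (1 + b + if c ≤ a h then len h else 0) +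
        ∑ q ∈ Finset.range h, momentExcess p (1 + len q) := by
  rw [Finset.sum_congr rfl fun q hq => by
    rw [card_filter_itemPositions ha hh hc (Finset.mem_range.1 hq)]]
  rw [← Finset.sum_subset (Finset.range_mono (Nat.succ_le_of_lt hh)) (fun q _ hq => by
    rw [Finset.mem_range] at hq
    rw [if_neg (by omega), if_neg (by omega)]
    exact momentExcess_one p)]
  rw [Finset.sum_range_succ, if_neg (lt_irrefl _), if_pos rfl, ← add_assoc, add_comm]
  congr 1
  exact Finset.sum_congr rfl fun q hq => by rw [if_pos (Finset.mem_range.1 hq)]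

end Layout

/-! ### Binary search for a symbol -/

/-- The number with binary digits those of `a` above digit `j`, then a one and zeros. -/
def bitThreshold (a j : ℕ) : ℕ := (2 * (a / 2 ^ (j + 1)) + 1) * 2 ^ j

/-- A digit is thus read by one comparison, with a threshold that depends only on the higher digits.
-/
theorem bitThreshold_le_iff (a j : ℕ) : bitThreshold a j ≤ a ↔ a / 2 ^ j % 2 = 1 := by
  rw [bitThreshold, ← Nat.le_div_iff_mul_le (by positivity), pow_succ, ← Nat.div_div_eq_div_mul]
  omega

theorem bitThreshold_le_two_pow {a j β : ℕ} (ha : a < 2 ^ β) (hj : j < β) :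
    bitThreshold a j ≤ 2 ^ β := by
  have e : 2 ^ β = 2 ^ (β - (j + 1)) * 2 ^ (j + 1) := by rw [← pow_add]; congr 1; omega
  have h1 : a / 2 ^ (j + 1) < 2 ^ (β - (j + 1)) := by
    rw [Nat.div_lt_iff_lt_mul (by positivity), ← e]; exact ha
  calc bitThreshold a j ≤ (a / 2 ^ (j + 1) + 1) * 2 ^ (j + 1) := by
        rw [bitThreshold, pow_succ]; nlinarith [Nat.pos_of_ne_zero (pow_ne_zero j two_ne_zero)]
    _ ≤ 2 ^ (β - (j + 1)) * 2 ^ (j + 1) := Nat.mul_le_mul_right _ h1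
    _ = _ := e.symm

/-- A message is determined by its binary digits, each read off given the higher ones. -/
theorem eq_of_forall_digit_eq {a a' β : ℕ} (ha : a < 2 ^ β) (ha' : a' < 2 ^ β)
    (h : ∀ j < β, a / 2 ^ (j + 1) = a' / 2 ^ (j + 1) → a / 2 ^ j % 2 = a' / 2 ^ j % 2) :
    a = a' := by
  have key : ∀ i ≤ β, a / 2 ^ (β - i) = a' / 2 ^ (β - i) := by
    intro i
    induction i with
    | zero => intro _; rw [Nat.sub_zero, Nat.div_eq_of_lt ha, Nat.div_eq_of_lt ha']
    | succ i ih =>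
      intro hi
      have h1 := ih (by omega)
      rw [show β - i = β - (i + 1) + 1 by omega] at h1
      have h2 := h (β - (i + 1)) (by omega) h1
      rw [pow_succ, ← Nat.div_div_eq_div_mul, ← Nat.div_div_eq_div_mul] at h1
      omega
  simpa using key β le_rfl

/-! ### Reduction to the counting bound -/

/-- The space bound for streams of `K` blocks that each encode `β` bits. -/
theorem mul_le_three_mul_space {Ω : Type*} [MeasurableSpace Ω] (μ : Measure Ω)
    [IsProbabilityMeasure μ] {n U m K β s : ℕ} {p ε : ℝ} (A : StreamingAlgorithm Ω U)
    (hp : 1 < p) (hn : 0 < n) (hU : n ≤ U) (hm : 2 * n ≤ m)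
    (hA : A.ApproximatesMoment μ p n m ε (1 / 10)) (hs : A.UsesSpaceAtMost μ m s)
    (len b : ℕ → ℕ) (hfit : K + blockOffset β len K ≤ n)
    (hb : ∀ q < K, K + blockOffset β len K + b q ≤ n)
    (hgap : ∀ q < K,
      (1 + ε) * (n + momentExcess p (1 + b q) +
          ∑ i ∈ Finset.range q, momentExcess p (1 + len i)) <
        (1 - ε) * (n + momentExcess p (1 + b q + len q) +
          ∑ i ∈ Finset.range q, momentExcess p (1 + len i))) :
    K * β ≤ 3 * s := by
  classical
  have hK : K ≤ n := by omega
  set L := K + blockOffset β len K with hL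
  let slot : (Fin K → Fin (2 ^ β)) → ℕ → ℕ := fun z q => if h : q < K then z ⟨q, h⟩ else 0
  have hslot : ∀ z, ∀ q < K, slot z q < 2 ^ β := by
    intro z q hq
    simp only [slot, dif_pos hq]
    exact (z ⟨q, hq⟩).2
  let x : (Fin K → Fin (2 ^ β)) → ℕ → ℕ → ℕ → Fin U := fun z h c =>
    overlayStream n K hn hK hU (itemPositions K β len (slot z) h c)
  -- Before time `L` the stream does not depend on the probe, and from `L` on it does not depend on
  -- the message. So the memory at `L` serves all queries.
  have hx_before : ∀ z h c h' c', ∀ t < L, x z h c t = x z h' c' t := by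
    intro z h c h' c' t ht
    refine Fin.ext (overlayItem_congr fun q _ => ?_)
    rw [mem_itemPositions, mem_itemPositions]
    omega
  have hx_after : ∀ z z' h c t, L ≤ t → x z h c t = x z' h c t := by
    intro z z' h c t ht
    refine Fin.ext (overlayItem_congr fun q hq => ?_)
    have e1 := slot_end_le (len := len) (hslot z) hq
    have e2 := slot_end_le (len := len) (hslot z') hq
    have e3 := blockStart_add (β := β) (len := len) hq
    rw [mem_itemPositions, mem_itemPositions]
    omega
  let start : (Fin K → Fin (2 ^ β)) → Fin K × Fin β → ℕ := fun z d =>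
    blockStart K β len d.1 + bitThreshold (slot z d.1) d.2 * len d.1
  have hcut : ∀ z (d : Fin K × Fin β), bitThreshold (slot z d.1) d.2 ≤ 2 ^ β := fun z d =>
    bitThreshold_le_two_pow (hslot z d.1 d.1.2) d.2.2
  have hstart : ∀ z d, K ≤ start z d ∧ start z d ≤ L := by
    intro z d
    have e1 : bitThreshold (slot z d.1) d.2 * len d.1 ≤ 2 ^ β * len d.1 :=
      Nat.mul_le_mul_right _ (hcut z d)
    have e2 := blockStart_add (β := β) (len := len) d.1.2
    have e3 : K ≤ blockStart K β len d.1 := Nat.le_add_right _ _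
    simp only [start]
    omega
  have hmoment : ∀ z (d : Fin K × Fin β),
      windowMoment p (x z d.1 (b d.1)) n (start z d + n) =
        n + momentExcess p (1 + b d.1 + if slot z d.1 / 2 ^ (d.2 : ℕ) % 2 = 1
          then len d.1 else 0) + ∑ i ∈ Finset.range d.1, momentExcess p (1 + len i) := by
    intro z d
    rw [windowMoment_overlayStream hp hn hK hU (disjoint_itemPositions (hslot z))
      (lt_of_mem_itemPositions (hslot z) (hb d.1 d.1.2)) (hstart z d).1
      ((hstart z d).2.trans hfit),
      sum_momentExcess_itemPositions p (hslot z) d.1.2 (hcut z d)]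
    simp only [bitThreshold_le_iff, add_assoc]
  -- The largest answer permitted when the digit is 0; by `hgap`, every answer permitted for digit 1
  -- exceeds it.
  let τ : Fin K → ℝ := fun q => (1 + ε) * (n + momentExcess p (1 + b q) +
    ∑ i ∈ Finset.range q, momentExcess p (1 + len i))
  let bit : (Fin K → Fin (2 ^ β)) → Fin K × Fin β → Prop := fun z d =>
    slot z d.1 / 2 ^ (d.2 : ℕ) % 2 = 1
  let guess : Ω → (Fin K → Fin (2 ^ β)) → Fin K × Fin β → Prop := fun ω z d =>
    τ d.1 < A.estimate ω (x z d.1 (b d.1)) (start z d + n)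
  let bad : (Fin K → Fin (2 ^ β)) × (Fin K × Fin β) → Set Ω := fun y =>
    {ω | A.estimate ω (x y.1 y.2.1 (b y.2.1)) (start y.1 y.2 + n) ∉
      Set.Icc ((1 - ε) * windowMoment p (x y.1 y.2.1 (b y.2.1)) n (start y.1 y.2 + n))
        ((1 + ε) * windowMoment p (x y.1 y.2.1 (b y.2.1)) n (start y.1 y.2 + n))}
  have hbad : ∀ y, μ (bad y) ≤ ENNReal.ofReal (1 / 10) := by
    intro y
    have := (hstart y.1 y.2).2
    exact hA _ _ (Nat.le_add_left _ _) (by omega)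
  have herr : ∀ ω z d, ω ∉ bad (z, d) → (guess ω z d ↔ bit z d) := by
    intro ω z d hω
    simp only [bad, Set.mem_ofPred_eq, not_not, hmoment] at hω
    simp only [guess, bit]
    by_cases hbit : slot z d.1 / 2 ^ (d.2 : ℕ) % 2 = 1
    · simp only [hbit, if_true] at hω
      exact iff_of_true ((hgap d.1 d.1.2).trans_le hω.1) hbit
    · simp only [hbit, if_false, add_zero] at hω
      exact iff_of_false (not_lt.2 hω.2) hbit
  obtain ⟨ω, hspace, hsum⟩ := exists_sum_indicator_le μ bad (by norm_num) hbad
    (P := fun ω => ∀ z, (A.memory ω (x z 0 0) L).length ≤ s)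
    (ae_all_iff.2 fun z => hs (x z 0 0) L (by omega))
  have hfinal := card_le_three_mul_of_error_correcting
    (fun z => A.memory ω (x z 0 0) L) hspace
    (fun z d => decide (¬(guess ω z d ↔ bit z d))) ?_ ?_ ?_
  · simpa using hfinal
  · intro z z' hzz
    obtain ⟨hM, hE⟩ := Prod.mk.inj hzz
    funext q
    -- Equal higher digits give the same query time, equal memories then give the same guess, and
    -- equal error flags turn it into the same digit.
    refine Fin.ext (eq_of_forall_digit_eq (z q).2 (z' q).2 fun j hj hq => ?_)
    have hzs : ∀ y : Fin K → Fin (2 ^ β), slot y q = y q := fun y => by simp [slot]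
    have hd := congrFun hE (q, ⟨j, hj⟩)
    have hst : start z (q, ⟨j, hj⟩) = start z' (q, ⟨j, hj⟩) := by
      simp only [start, bitThreshold, hzs, hq]
    have hmem : A.memory ω (x z q (b q)) (start z (q, ⟨j, hj⟩) + n) =
        A.memory ω (x z' q (b q)) (start z (q, ⟨j, hj⟩) + n) := by
      refine A.memory_eq_of_memory_eq ω (L := L) (by omega) ?_ fun t ht _ => hx_after _ _ _ _ t ht
      rw [A.memory_congr ω (hx_before z q (b q) 0 0), A.memory_congr ω (hx_before z' q (b q) 0 0)]
      exact hM
    have hg : guess ω z (q, ⟨j, hj⟩) ↔ guess ω z' (q, ⟨j, hj⟩) := by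
      simp only [guess, StreamingAlgorithm.estimate, ← hst, hmem]
    have hbb : bit z (q, ⟨j, hj⟩) ↔ bit z' (q, ⟨j, hj⟩) := by
      have := decide_eq_decide.1 hd
      tauto
    simp only [bit, hzs] at hbb
    omega
  · simp only [Fintype.card_fun, Fintype.card_fin, Fintype.card_prod, ← pow_mul, mul_comm]
  · refine le_trans ?_ (hsum.trans_eq ?_)
    · rw [Fintype.sum_prod_type]
      refine Finset.sum_le_sum fun z _ => Finset.sum_le_sum fun d _ => ?_
      by_cases h : ω ∈ bad (z, d)
      · rw [Set.indicator_of_mem h]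
        split_ifs <;> norm_num
      · simp [h, herr ω z d h]
    · rw [Fintype.card_prod]
      push_cast
      ring

/-! ### Geometric run lengths -/

/-- Run lengths that grow by a factor of 32 after every `k` blocks. -/
def geometricRunLength (l k q : ℕ) : ℕ := l * 32 ^ (q / k)

section RunLength

variable {l k : ℕ}

theorem le_geometricRunLength (q : ℕ) : l ≤ geometricRunLength l k q :=
  Nat.le_mul_of_pos_right _ (by positivity)

theorem geometricRunLength_mono : Monotone (geometricRunLength l k) := fun _ _ h =>
  Nat.mul_le_mul_left _ (Nat.pow_le_pow_right (by norm_num) (Nat.div_le_div_right h))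

/-- Within a group of `k` blocks each step adds 23 to the coefficient. At the end of a group it has
reached `24 * k`, and the growth resets it to `k`, since `24 * (len + 1) ≤ 32 * len + 1` for `len ≥
3`. -/
theorem sum_geometricRunLength_le (hk : 1 ≤ k) (hl : 3 ≤ l) (q : ℕ) :
    23 * ∑ i ∈ Finset.range q, (geometricRunLength l k i + 1) ≤
      (23 * (q % k) + k) * (geometricRunLength l k q + 1) := by
  induction q with
  | zero => simp
  | succ q ih =>
    have hq : l ≤ geometricRunLength l k q := le_geometricRunLength q
    rw [Finset.sum_range_succ, mul_add]
    by_cases hd : k ∣ q + 1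
    · have h1 : q % k + 1 = k := by
        have h2 := Nat.mod_lt q hk
        obtain ⟨c, hc⟩ := hd
        have h3 := Nat.div_add_mod q k
        have h4 : k * c = k * (q / k) + (q % k + 1) := by omega
        have h5 : k ∣ q % k + 1 := (Nat.dvd_add_right (Dvd.intro _ rfl)).1 (Dvd.intro c h4)
        exact le_antisymm h2 (Nat.le_of_dvd (Nat.succ_pos _) h5)
      have h2 : (q + 1) % k = 0 := Nat.mod_eq_zero_of_dvd hd
      have h3 : geometricRunLength l k (q + 1) = 32 * geometricRunLength l k q := by
        rw [geometricRunLength, geometricRunLength, Nat.succ_div_of_dvd hd, pow_succ]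
        ring
      rw [h2, h3]
      have h4 : (23 * (q % k) + k) + 23 = 24 * k := by omega
      calc _ ≤ (23 * (q % k) + k) * (geometricRunLength l k q + 1) +
            23 * (geometricRunLength l k q + 1) := by gcongr
        _ = k * (24 * (geometricRunLength l k q + 1)) := by rw [← add_mul, h4]; ring
        _ ≤ k * (32 * geometricRunLength l k q + 1) := Nat.mul_le_mul_left _ (by omega)
        _ = _ := by ring
    · have h1 : geometricRunLength l k (q + 1) = geometricRunLength l k q := by
        rw [geometricRunLength, geometricRunLength, Nat.succ_div_of_not_dvd hd]
      have h2 : (q + 1) % k = q % k + 1 := by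
        have h3 := Nat.div_add_mod (q + 1) k
        rw [Nat.succ_div_of_not_dvd hd] at h3
        have h4 := Nat.div_add_mod q k
        omega
      rw [h1, h2]
      calc _ ≤ (23 * (q % k) + k) * (geometricRunLength l k q + 1) +
            23 * (geometricRunLength l k q + 1) := by gcongr
        _ = _ := by ring

/-- Bounding all but one factor of each power by the largest length reduces this to the linear sum,
whose coefficient is at most `24 * k`. -/
theorem sum_momentExcess_geometricRunLength_le {p : ℝ} (hp : 1 < p) (hk : 1 ≤ k) (hl : 3 ≤ l)
    (q : ℕ) : ∑ i ∈ Finset.range q, momentExcess p (1 + geometricRunLength l k i) ≤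
      24 / 23 * (k * ((geometricRunLength l k q : ℝ) + 1) ^ p) := by
  set w : ℝ := (geometricRunLength l k q : ℝ) + 1
  have hw : 0 < w := by positivity
  have hwp : w ^ p = w * w ^ (p - 1) := by
    rw [mul_comm, ← Real.rpow_add_one hw.ne', sub_add_cancel]
  have hterm : ∀ i ∈ Finset.range q, momentExcess p (1 + geometricRunLength l k i) ≤
      ((geometricRunLength l k i : ℝ) + 1) * w ^ (p - 1) := by
    intro i hi
    refine (momentExcess_le p _).trans ?_
    push_cast
    rw [add_comm (1 : ℝ)]
    have h0 : (0 : ℝ) < (geometricRunLength l k i : ℝ) + 1 := by positivity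
    have h1 : (geometricRunLength l k i : ℝ) + 1 ≤ w := by
      have := geometricRunLength_mono (l := l) (k := k) (Finset.mem_range.1 hi).le
      exact add_le_add_left (by exact_mod_cast this) 1
    calc _ = ((geometricRunLength l k i : ℝ) + 1) *
          ((geometricRunLength l k i : ℝ) + 1) ^ (p - 1) := by
          rw [mul_comm, ← Real.rpow_add_one h0.ne', sub_add_cancel]
      _ ≤ _ := by
          gcongr
  have hsum := sum_geometricRunLength_le hk hl q
  have hsum' : 23 * ∑ i ∈ Finset.range q, ((geometricRunLength l k i : ℝ) + 1) ≤
      24 * k * w := by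
    have h1 : 23 * ∑ i ∈ Finset.range q, ((geometricRunLength l k i : ℝ) + 1) ≤
        (23 * ((q % k : ℕ) : ℝ) + k) * w := by
      have := (Nat.cast_le (α := ℝ)).2 hsum
      push_cast at this
      exact this
    have h2 : ((q % k : ℕ) : ℝ) ≤ k := by exact_mod_cast (Nat.mod_lt q hk).le
    refine h1.trans ?_
    gcongr
    linarith
  refine (Finset.sum_le_sum hterm).trans ?_
  rw [← Finset.sum_mul, hwp]
  have h3 : 0 < w ^ (p - 1) := by positivity
  nlinarith

/-- The 17 is `16 + 1`: `32 ^ t ≤ 16 * 2 ^ r`, and one more `l * 2 ^ r` absorbs the added 1. At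
least `6 * n / 23` positions remain, more than the `n / 4` that suffice for the probing copies. -/
theorem blockOffset_geometricRunLength_le {β N r t n : ℕ} (hk : 1 ≤ k) (hl : 4 ≤ l)
    (hN : 2 ^ β ≤ N) (ht : 5 * t ≤ r + 4) (hn : l * (2 ^ r * N * k) ≤ n) :
    23 * (k * t + blockOffset β (geometricRunLength l k) (k * t)) ≤ 17 * n := by
  have h1 := sum_geometricRunLength_le hk (by omega : 3 ≤ l) (k * t)
  have h2 : k * t + blockOffset β (geometricRunLength l k) (k * t) ≤
      N * ∑ i ∈ Finset.range (k * t), (geometricRunLength l k i + 1) := by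
    refine le_trans ?_ (Nat.mul_le_mul_right _ hN)
    rw [Finset.sum_add_distrib, mul_add, Finset.mul_sum, Finset.sum_const, Finset.card_range,
      smul_eq_mul, mul_one, add_comm]
    exact Nat.add_le_add_left (Nat.le_mul_of_pos_left _ (by positivity)) _
  have h3 : geometricRunLength l k (k * t) ≤ l * (16 * 2 ^ r) := by
    rw [geometricRunLength, Nat.mul_div_cancel_left _ hk]
    refine Nat.mul_le_mul_left _ ?_
    calc 32 ^ t = 2 ^ (5 * t) := by rw [pow_mul]; norm_num
      _ ≤ 2 ^ (r + 4) := Nat.pow_le_pow_right (by norm_num) ht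
      _ = _ := by rw [pow_add]; ring
  rw [Nat.mul_mod_right, mul_zero, zero_add] at h1
  have h4 : 1 ≤ l * 2 ^ r := Nat.mul_pos (by omega) (by positivity)
  calc 23 * (k * t + blockOffset β (geometricRunLength l k) (k * t))
      ≤ 23 * (N * ∑ i ∈ Finset.range (k * t), (geometricRunLength l k i + 1)) :=
        Nat.mul_le_mul_left _ h2
    _ = N * (23 * ∑ i ∈ Finset.range (k * t), (geometricRunLength l k i + 1)) := by ring
    _ ≤ N * (k * (l * (16 * 2 ^ r) + l * 2 ^ r)) := by
        refine Nat.mul_le_mul_left _ (h1.trans (Nat.mul_le_mul_left _ ?_))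
        omega
    _ = 17 * (l * (2 ^ r * N * k)) := by ring
    _ ≤ _ := Nat.mul_le_mul_left _ hn

theorem mul_geometricRunLength_le {N r t n q : ℕ} (hN : 2 ≤ N) (hr : 1 ≤ r)
    (ht : 5 * t ≤ r + 4) (hn : l * (2 ^ r * N * k) ≤ n) (hq : q < k * t) :
    4 * (k * geometricRunLength l k q) ≤ n := by
  have h1 : q / k < t := Nat.div_lt_of_lt_mul hq
  have h2 : 32 ^ (q / k) ≤ 2 ^ (r - 1) := by
    calc 32 ^ (q / k) = 2 ^ (5 * (q / k)) := by rw [pow_mul]; norm_num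
      _ ≤ _ := Nat.pow_le_pow_right (by norm_num) (by omega)
  have h3 : 2 ^ r = 2 ^ (r - 1) * 2 := by rw [← pow_succ, Nat.sub_add_cancel hr]
  calc 4 * (k * geometricRunLength l k q) ≤ 4 * (k * (l * 2 ^ (r - 1))) := by
        unfold geometricRunLength
        gcongr
    _ = l * (2 ^ (r - 1) * 2 * 2 * k) := by ring
    _ ≤ l * (2 ^ (r - 1) * 2 * N * k) := by gcongr
    _ ≤ n := by rwa [← h3]

end RunLength

/-! ### Choice of parameters -/

theorem mainTheorem4 :
    ∃ c : ℝ, 0 < c ∧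
      ∀ (p : ℝ) (n U N k r m : ℕ), 1 < p → p ≤ 2 → 1 ≤ N → 1 ≤ k →
        n ≤ U →
        (2 : ℝ) ^ r * (N : ℝ) * (k : ℝ) ^ (1 - 1 / p) ≤ (n : ℝ) ^ (1 - 1 / p) →
        2 ^ r * N * k ≤ n →
        2 * n ≤ m →
        ∀ (Ω : Type*) [MeasurableSpace Ω] (μ : Measure Ω) [IsProbabilityMeasure μ]
          (A : StreamingAlgorithm Ω U),
          A.ApproximatesMoment μ p n m (1 / (12 * (k : ℝ) ^ (1 / p))) (1 / 10) →
          ∀ s : ℕ, A.UsesSpaceAtMost μ m s →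
            c * ((k : ℝ) * (r : ℝ) * Real.log (N : ℝ)) ≤ (s : ℝ) := by
  -- From `r ≤ 5 * t`, `log N ≤ 2 * β` and `k * t * β ≤ 3 * s`, the constant is `1 / (5 * 2 * 3)`.
  refine ⟨1 / 30, by norm_num, ?_⟩
  intro p n U N k r m hp1 hp2 hN hk hU hcond hfit hm Ω _ μ _ A hA s hs
  rcases Nat.eq_zero_or_pos r with rfl | hr
  · simp
  rcases hN.eq_or_lt with rfl | hN2
  · simp
  have hN2 : 2 ≤ N := hN2
  have hΓ : 4 ≤ 2 ^ r * N := by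
    have : 2 ^ 1 ≤ 2 ^ r := Nat.pow_le_pow_right (by norm_num) hr
    nlinarith
  obtain ⟨hl1, hl2, hl3, hl4⟩ := base_run_length_bounds hp1 hp2 hk hΓ (by exact_mod_cast hcond)
  set l := n / (2 ^ r * N * k)
  have hln : l * (2 ^ r * N * k) ≤ n := Nat.div_mul_le_self _ _
  have hl : 4 ≤ l := hΓ.trans hl4
  set β := Nat.log 2 N with hβ
  have hβN : 2 ^ β ≤ N := Nat.pow_log_le_self 2 (by omega)
  have hβ1 : 1 ≤ β := Nat.log_pos (by norm_num) hN2
  -- Rounding up keeps `t ≥ 1` for small `r`.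
  set t := (r + 4) / 5 with ht
  have hoff := blockOffset_geometricRunLength_le hk hl hβN (by omega : 5 * t ≤ r + 4) hln
  have hk1 : (1 : ℝ) ≤ k := by exact_mod_cast hk
  have hκ : (k : ℝ) ^ (1 / p) ≤ k := by
    have h1 : 1 / p ≤ 1 := by rw [div_le_one (by linarith)]; exact hp1.le
    have := Real.rpow_le_rpow_of_exponent_le hk1 h1
    rwa [Real.rpow_one] at this
  have hmain : k * t * β ≤ 3 * s := by
    refine mul_le_three_mul_space μ A hp1 (by nlinarith) hU hm hA hs (geometricRunLength l k)
      (fun q => ⌊(k : ℝ) ^ (1 / p) * geometricRunLength l k q⌋₊) (by omega) ?_ ?_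
    · intro q hq
      have h1 := mul_geometricRunLength_le hN2 hr (by omega : 5 * t ≤ r + 4) hln hq
      have h2 : ⌊(k : ℝ) ^ (1 / p) * geometricRunLength l k q⌋₊ ≤
          k * geometricRunLength l k q := by
        refine Nat.floor_le_of_le ?_
        push_cast
        gcongr
      omega
    · intro q _
      have hlq : (l : ℝ) ≤ geometricRunLength l k q := by
        exact_mod_cast le_geometricRunLength q
      refine moment_gap hp1 hp2 hk (hl1.trans hlq)
        (hl2.trans (Real.rpow_le_rpow (by positivity) hlq (by linarith))) rfl
        (hl3.trans ?_) (sum_momentExcess_geometricRunLength_le hp1 hk (by omega) q)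
      gcongr
  have hlog : Real.log N ≤ 2 * β := by
    have h1 : (N : ℝ) ≤ 2 ^ (β + 1) := by
      exact_mod_cast (Nat.lt_pow_succ_log_self (by norm_num) N).le
    have h2 := Real.log_le_log (by positivity) h1
    rw [Real.log_pow] at h2
    have h3 : Real.log 2 ≤ 1 := by linarith [Real.log_two_lt_d9]
    have h4 : (1 : ℝ) ≤ β := by exact_mod_cast hβ1
    push_cast at h2
    nlinarith
  have hrt : (r : ℝ) ≤ 5 * t := by exact_mod_cast (by omega : r ≤ 5 * t)
  have hmain' : (k : ℝ) * t * β ≤ 3 * s := by exact_mod_cast hmain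
  have hprod : (k : ℝ) * r * Real.log N ≤ k * (5 * t) * (2 * β) := by
    have : 0 ≤ Real.log N := Real.log_natCast_nonneg N
    gcongr
  linarith
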